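/- Let $n\ge 0$ and $1\le r\le\infty$, and let $V\subset\mathbb R^n$ be a compact connected (non-empty) $n$-dimensional smooth submanifold with boundary $\partial V$, i.e. every point of $V$ is either an interior point of $V$ or has an open neighbourhood $U$ in $\mathbb R^n$ with a $C^\infty$ diffeomorphism from $U$ onto an open subset $U'\subset\mathbb R^n$ carrying $U\cap V$ onto the intersection of $U'$ with a closed coordinate half-space $\{u: u_i\ge 0\}$; $\partial V$ is the set of points that such a diffeomorphism maps into $\{u_i=0\}$. Let $\mathrm{Diff}^{\,r}(V,\partial V)$ be the group of all $C^r$-diffeomorphisms of $V$ that fix $\partial V$ pointwise, and let $\mathrm{Bilip}(\mathbb R^n)$ be the group of all homeomorphisms $f$ of $\mathbb R^n$ such that, for some $\lambda\ge 1$, $\lambda^{-1}\|x-y\|\le\|f(x)-f(y)\|\le\lambda\|x-y\|$ for all $x,y$. Then there is an injective group homomorphism $\Psi:\mathrm{Diff}^{\,r}(V,\partial V)\to\mathrm{Bilip}(\mathbb R^n)$ such that $$\|\Psi(f)-\mathrm{id}\|:=\sup_{x\in\mathbb R^n}\|\Psi(f)(x)-x\|=\infty$$ for every non-trivial $f\in\mathrm{Diff}^{\,r}(V,\partial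 V)$. Consequently, for every finite generating set $A$ of $\mathbb Z^n$, there is an injective group homomorphism from $\mathrm{Diff}^{\,r}(V,\partial V)$ into the quasi-isometry group $\mathcal{QI}(\mathbb Z^n)$, where $\mathbb Z^n$ carries the word metric of $A$. Here $\mathcal{QI}(X)$, for a metric space $X$, is the group (under composition) of all self-quasi-isometries of $X$ modulo the relation $f\sim g\iff\sup_{x\in X} d(f(x),g(x))<\infty$; a self-quasi-isometry is a map $f:X\to X$ for which there are constants $\lambda\ge1$, $\epsilon\ge0$, $C$ with $\lambda^{-1}d(x,y)-\epsilon\le d(f(x),f(y))\le\lambda d(x,y)+\epsilon$ for all $x,y\in X$ and such that every point of $X$ is within distance $C$ of $f(X)$. -/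

import Mathlib

open scoped ENNReal ContDiff

/-! ### Bi-Lipschitz homeomorphisms and the uniform distance -/

/-- `f` is bi-Lipschitz: `(1/L) d(x,y) ≤ d(f x, f y) ≤ L d(x,y)` for some `L ≥ 1`. -/
def IsBilip {X : Type*} [MetricSpace X] (f : X → X) : Prop :=
  ∃ L : ℝ, 1 ≤ L ∧ ∀ x y, L⁻¹ * dist x y ≤ dist (f x) (f y) ∧ dist (f x) (f y) ≤ L * dist x y

/-- `Bilip(X)`, the group of all bi-Lipschitz homeomorphisms of `X` (under composition). -/
def Bilip (X : Type*) [MetricSpace X] : Subgroup (X ≃ₜ X) where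
  carrier := {f | IsBilip f}
  one_mem' := ⟨1, le_rfl, fun x y => by simp⟩
  mul_mem' := by
    rintro f g ⟨L, hL, hf⟩ ⟨M, hM, hg⟩
    refine ⟨L * M, one_le_mul_of_one_le_of_one_le hL hM, fun x y => ⟨?_, ?_⟩⟩
    · calc (L * M)⁻¹ * dist x y = L⁻¹ * (M⁻¹ * dist x y) := by rw [mul_inv, mul_assoc]
        _ ≤ L⁻¹ * dist (g x) (g y) := by gcongr; exact (hg x y).1
        _ ≤ _ := (hf _ _).1
    · calc dist (f (g x)) (f (g y)) ≤ L * dist (g x) (g y) := (hf _ _).2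
        _ ≤ L * (M * dist x y) := by gcongr; exact (hg x y).2
        _ = L * M * dist x y := by ring
  inv_mem' := by
    rintro f ⟨L, hL, hf⟩
    have hL0 : 0 < L := by linarith
    refine ⟨L, hL, fun x y => ?_⟩
    have h := hf (f.symm x) (f.symm y)
    simp only [Homeomorph.apply_symm_apply] at h
    change L⁻¹ * dist x y ≤ dist (f.symm x) (f.symm y) ∧
      dist (f.symm x) (f.symm y) ≤ L * dist x y
    exact ⟨(inv_mul_le_iff₀ hL0).2 h.2, (inv_mul_le_iff₀ hL0).1 h.1⟩

/-- `‖f - g‖ = sup_x ‖f x - g x‖ ∈ [0, ∞]`. -/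
noncomputable def uniformDist {X : Type*} [MetricSpace X] (f g : X → X) : ℝ≥0∞ :=
  ⨆ x, edist (f x) (g x)

/-! ### Quasi-isometries and the quasi-isometry group -/

section QI

/-- `f : X → X` is a self-quasi-isometry: a `(L, ε)`-quasi-isometric embedding with `C`-dense
image, for some constants `L ≥ 1`, `ε ≥ 0` and `C`. -/
def IsQuasiIsometry {X : Type*} [MetricSpace X] (f : X → X) : Prop :=
  ∃ L ε C : ℝ, 1 ≤ L ∧ 0 ≤ ε ∧
    (∀ x y, L⁻¹ * dist x y - ε ≤ dist (f x) (f y) ∧ dist (f x) (f y) ≤ L * dist x y + ε) ∧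
    ∀ y, ∃ x, dist (f x) y ≤ C

/-- The monoid of all self-quasi-isometries of `X` under composition. -/
def quasiIsometries (X : Type*) [MetricSpace X] : Submonoid (Function.End X) where
  carrier := {f | IsQuasiIsometry f}
  one_mem' := ⟨1, 0, 0, le_rfl, le_rfl, fun x y => by simp [Function.End.one_def],
    fun y => ⟨y, by simp [Function.End.one_def]⟩⟩
  mul_mem' := by
    rintro f g ⟨L, ε, C, hL, hε, hf, hfC⟩ ⟨M, δ, D, hM, hδ, hg, hgD⟩
    have hL0 : 0 < L := by linarith
    have hLi : L⁻¹ ≤ L := (inv_le_one_of_one_le₀ hL).trans hL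
    refine ⟨L * M, L * δ + ε, C + (L * D + ε), one_le_mul_of_one_le_of_one_le hL hM,
      by positivity, fun x y => ⟨?_, ?_⟩, fun y => ?_⟩
    · change _ ≤ dist (f (g x)) (f (g y))
      have h1 := (hf (g x) (g y)).1
      have h2 : L⁻¹ * (M⁻¹ * dist x y - δ) ≤ L⁻¹ * dist (g x) (g y) := by
        gcongr; exact (hg x y).1
      have h3 : L⁻¹ * δ ≤ L * δ := by gcongr
      rw [mul_inv]
      linarith
    · change dist (f (g x)) (f (g y)) ≤ _
      have h1 := (hf (g x) (g y)).2
      have h2 : L * dist (g x) (g y) ≤ L * (M * dist x y + δ) := by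
        gcongr; exact (hg x y).2
      linarith
    · obtain ⟨z, hz⟩ := hfC y
      obtain ⟨x, hx⟩ := hgD z
      refine ⟨x, ?_⟩
      change dist (f (g x)) y ≤ _
      have h1 := dist_triangle (f (g x)) (f z) y
      have h2 := (hf (g x) z).2
      have h3 : L * dist (g x) z ≤ L * D := by gcongr
      linarith

/-- Two self-quasi-isometries are equivalent when they are at finite uniform distance. -/
def quasiIsometryCon (X : Type*) [MetricSpace X] : Con (quasiIsometries X) where
  r f g := ∃ K : ℝ, ∀ x, dist (f.1 x) (g.1 x) ≤ K
  iseqv :=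
    { refl := fun f => ⟨0, fun x => by simp⟩
      symm := fun ⟨K, h⟩ => ⟨K, fun x => by rw [dist_comm]; exact h x⟩
      trans := fun ⟨K, h⟩ ⟨K', h'⟩ =>
        ⟨K + K', fun x => (dist_triangle _ _ _).trans (add_le_add (h x) (h' x))⟩ }
  mul' := by
    rintro ⟨f, L, ε, C, hL, hε, hf, hfC⟩ f' g g' ⟨K, hK⟩ ⟨K', hK'⟩
    refine ⟨L * K' + ε + K, fun x => ?_⟩
    change dist (f (g.1 x)) (f'.1 (g'.1 x)) ≤ _
    have h1 := dist_triangle (f (g.1 x)) (f (g'.1 x)) (f'.1 (g'.1 x))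
    have h2 := (hf (g.1 x) (g'.1 x)).2
    have h3 : L * dist (g.1 x) (g'.1 x) ≤ L * K' := by gcongr; exact hK' x
    have h4 : dist (f (g'.1 x)) (f'.1 (g'.1 x)) ≤ K := hK _
    linarith

/-- `QI(X)`: the self-quasi-isometries of `X` modulo finite uniform distance. -/
def QI (X : Type*) [MetricSpace X] : Type _ := (quasiIsometryCon X).Quotient

instance (X : Type*) [MetricSpace X] : Monoid (QI X) :=
  inferInstanceAs (Monoid (quasiIsometryCon X).Quotient)

/-- Every class of self-quasi-isometries has a left inverse (the class of a quasi-inverse). -/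
theorem QI.exists_left_inv {X : Type*} [MetricSpace X] (q : QI X) : ∃ p : QI X, p * q = 1 := by
  refine Con.induction_on q ?_
  rintro ⟨f, hfq⟩
  obtain ⟨L, ε, C, hL, hε, hf, hfC⟩ := id hfq
  have hL0 : 0 < L := by linarith
  choose g hg using hfC
  have key : ∀ a b, dist a b ≤ L * (dist (f a) (f b) + ε) := fun a b => by
    have := (hf a b).1
    rw [← inv_mul_le_iff₀ hL0]
    linarith
  have hgq : IsQuasiIsometry g := by
    refine ⟨L, L * (2 * |C| + ε), L * (C + ε), hL, by positivity, fun x y => ⟨?_, ?_⟩,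
      fun y => ⟨f y, ?_⟩⟩
    · have h1 := dist_triangle4 x (f (g x)) (f (g y)) y
      have h2 := hg x
      have h3 := hg y
      rw [dist_comm] at h2
      have h4 := (hf (g x) (g y)).2
      have h5 : dist x y ≤ L * dist (g x) (g y) + (2 * |C| + ε) := by
        linarith [le_abs_self C]
      have h6 : 2 * |C| + ε ≤ L * (L * (2 * |C| + ε)) := by
        have h7 : 0 ≤ 2 * |C| + ε := by positivity
        nlinarith [mul_nonneg (by linarith : 0 ≤ L - 1) h7,
          mul_nonneg (mul_nonneg hL0.le (by linarith : 0 ≤ L - 1)) h7]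
      rw [sub_le_iff_le_add, inv_mul_le_iff₀ hL0]
      linarith
    · have h1 := key (g x) (g y)
      have h2 := dist_triangle4 (f (g x)) x y (f (g y))
      have h3 := hg x
      have h4 := hg y
      rw [dist_comm] at h4
      have h5 : L * (dist (f (g x)) (f (g y)) + ε) ≤ L * (dist x y + 2 * |C| + ε) := by
        gcongr
        linarith [le_abs_self C]
      linarith
    · refine (key _ _).trans ?_
      gcongr
      exact hg _
  refine ⟨((⟨g, hgq⟩ : quasiIsometries X) : (quasiIsometryCon X).Quotient), ?_⟩
  refine (quasiIsometryCon X).eq.2 ⟨L * (C + ε), fun x => ?_⟩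
  change dist (g (f x)) x ≤ _
  refine (key _ _).trans ?_
  gcongr
  exact hg _

noncomputable instance (X : Type*) [MetricSpace X] : Group (QI X) :=
  { (inferInstance : Monoid (QI X)) with
    inv := fun q => (QI.exists_left_inv q).choose
    inv_mul_cancel := fun q => (QI.exists_left_inv q).choose_spec }

end QI

/-! ### Word metrics -/

section WordMetric

/-- The length of `x` with respect to `A`: the least number of terms in an expression of `x` as a
sum of elements of `A` and their negatives. -/
noncomputable def wordLength {G : Type*} [AddGroup G] (A : Finset G) (x : G) : ℕ :=
  sInf {k | ∃ l : List G, l.length = k ∧ (∀ a ∈ l, a ∈ A ∨ -a ∈ A) ∧ l.sum = x}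

theorem wordLength_spec {G : Type*} [AddGroup G] {A : Finset G}
    (hA : AddSubgroup.closure (A : Set G) = ⊤) (x : G) :
    ∃ l : List G, l.length = wordLength A x ∧ (∀ a ∈ l, a ∈ A ∨ -a ∈ A) ∧ l.sum = x := by
  have hx : x ∈ AddSubgroup.closure (A : Set G) := by rw [hA]; trivial
  obtain ⟨l, hl, hs⟩ : ∃ l : List G, (∀ a ∈ l, a ∈ A ∨ -a ∈ A) ∧ l.sum = x := by
    induction hx using AddSubgroup.closure_induction'' with
    | zero => exact ⟨[], by simp, rfl⟩
    | mem a ha => exact ⟨[a], by simpa using Or.inl ha, by simp⟩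
    | neg_mem a ha => exact ⟨[-a], by simpa using Or.inr ha, by simp⟩
    | add a b _ _ iha ihb =>
      obtain ⟨l, hl, rfl⟩ := iha
      obtain ⟨m, hm, rfl⟩ := ihb
      refine ⟨l ++ m, fun c hc => ?_, List.sum_append⟩
      rcases List.mem_append.1 hc with h | h
      exacts [hl c h, hm c h]
  exact Nat.sInf_mem
    (s := {k | ∃ l : List G, l.length = k ∧ (∀ a ∈ l, a ∈ A ∨ -a ∈ A) ∧ l.sum = x})
    ⟨l.length, l, rfl, hl, hs⟩

theorem wordLength_le {G : Type*} [AddGroup G] {A : Finset G} (l : List G)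
    (hl : ∀ a ∈ l, a ∈ A ∨ -a ∈ A) : wordLength A l.sum ≤ l.length :=
  Nat.sInf_le ⟨l, rfl, hl, rfl⟩

theorem wordLength_neg_le {G : Type*} [AddGroup G] {A : Finset G}
    (hA : AddSubgroup.closure (A : Set G) = ⊤) (x : G) : wordLength A (-x) ≤ wordLength A x := by
  obtain ⟨l, hn, hl, rfl⟩ := wordLength_spec hA x
  rw [← hn, List.sum_neg_reverse]
  refine (wordLength_le _ fun a ha => ?_).trans (by simp)
  simp only [List.mem_reverse, List.mem_map] at ha
  obtain ⟨b, hb, rfl⟩ := ha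
  rw [neg_neg]
  exact (hl b hb).symm

/-- The group `G` regarded as a metric space with the word metric `d(x, y) = |-x + y|` of the finite
generating set `A`. -/
def WordSpace {G : Type*} [AddGroup G] (A : Finset G)
    (_hA : AddSubgroup.closure (A : Set G) = ⊤) : Type _ := G

noncomputable instance {G : Type*} [AddGroup G] (A : Finset G)
    (hA : AddSubgroup.closure (A : Set G) = ⊤) : MetricSpace (WordSpace A hA) where
  dist x y := (wordLength A (-(show G from x) + (show G from y)) : ℝ)
  dist_self x := by
    have h := wordLength_le (A := A) [] (by simp)
    rw [List.sum_nil, List.length_nil, Nat.le_zero] at h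
    rw [neg_add_cancel, h, Nat.cast_zero]
  dist_comm x y := by
    have key : ∀ x y : G, wordLength A (-x + y) ≤ wordLength A (-y + x) := fun x y => by
      simpa using wordLength_neg_le hA (-y + x)
    exact congrArg Nat.cast ((key x y).antisymm (key y x))
  dist_triangle x y z := by
    obtain ⟨l, hn, hl, hs⟩ := wordLength_spec hA (-(show G from x) + (show G from y))
    obtain ⟨m, hn', hm, ht⟩ := wordLength_spec hA (-(show G from y) + (show G from z))
    have h := wordLength_le (A := A) (l ++ m) (fun a ha => by
      rcases List.mem_append.1 ha with h | h
      exacts [hl a h, hm a h])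
    rw [List.sum_append, hs, ht, List.length_append, hn, hn'] at h
    have e : -(show G from x) + (show G from y) + (-(show G from y) + (show G from z)) =
        -(show G from x) + (show G from z) := by
      rw [add_assoc, add_neg_cancel_left]
    rw [e] at h
    exact_mod_cast h
  eq_of_dist_eq_zero := by
    intro x y h
    obtain ⟨l, hn, -, hs⟩ := wordLength_spec hA (-(show G from x) + (show G from y))
    have h0 : wordLength A (-(show G from x) + (show G from y)) = 0 := Nat.cast_eq_zero.1 h
    rw [h0, List.length_eq_zero_iff] at hn
    subst hn
    exact neg_add_eq_zero (G := G).1 hs.symm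

end WordMetric

/-! ### Codimension-zero submanifolds with boundary and their diffeomorphism groups -/

/-- A smooth chart of `ℝⁿ`: a `C^∞` diffeomorphism between open subsets of `ℝⁿ`. -/
def IsSmoothChart {n : ℕ}
    (e : OpenPartialHomeomorph (EuclideanSpace ℝ (Fin n)) (EuclideanSpace ℝ (Fin n))) : Prop :=
  ContDiffOn ℝ ∞ e e.source ∧ ContDiffOn ℝ ∞ e.symm e.target

/-- The chart `e` of `ℝⁿ` straightens `V` to the closed half-space `{u | 0 ≤ u i}`. -/
def IsHalfSpaceChart {n : ℕ} (V : Set (EuclideanSpace ℝ (Fin n)))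
    (e : OpenPartialHomeomorph (EuclideanSpace ℝ (Fin n)) (EuclideanSpace ℝ (Fin n)))
    (i : Fin n) : Prop :=
  IsSmoothChart e ∧ ∀ y ∈ e.source, (y ∈ V ↔ 0 ≤ e y i)

/-- `V ⊆ ℝⁿ` is an `n`-dimensional smooth submanifold with (possibly empty) boundary: near each of
its points `V` is either all of `ℝⁿ` or a closed half-space in a smooth chart of `ℝⁿ`. -/
def IsSmoothSubmanifoldWithBoundary {n : ℕ} (V : Set (EuclideanSpace ℝ (Fin n))) : Prop :=
  ∀ x ∈ V, V ∈ nhds x ∨ ∃ e i, x ∈ e.source ∧ IsHalfSpaceChart V e i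

/-- The manifold boundary `∂V`: the points of `V` that some half-space chart sends into the
bounding hyperplane. -/
def manifoldBoundary {n : ℕ} (V : Set (EuclideanSpace ℝ (Fin n))) :
    Set (EuclideanSpace ℝ (Fin n)) :=
  {x | x ∈ V ∧ ∃ e i, x ∈ e.source ∧ IsHalfSpaceChart V e i ∧ e x i = 0}

/-- A map `g : V → V` is of class `C^r` up to the boundary. The values of `G` off `V` play no role;
since the charts of `V` are restrictions of smooth charts of `ℝⁿ`, this is the `C^r` condition in
these charts. -/
def IsCr {n : ℕ} {V : Set (EuclideanSpace ℝ (Fin n))} (r : ℕ∞) (g : V → V) : Prop :=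
  ∃ G : EuclideanSpace ℝ (Fin n) → EuclideanSpace ℝ (Fin n),
    ContDiffOn ℝ r G V ∧ ∀ x : V, G x = g x

theorem IsCr.comp {n : ℕ} {V : Set (EuclideanSpace ℝ (Fin n))} {r : ℕ∞} {f g : V → V}
    (hf : IsCr r f) (hg : IsCr r g) : IsCr r (f ∘ g) := by
  obtain ⟨F, hF, hFf⟩ := hf
  obtain ⟨G, hG, hGg⟩ := hg
  refine ⟨F ∘ G, hF.comp hG fun x hx => ?_, fun x => ?_⟩
  · rw [hGg ⟨x, hx⟩]
    exact (g ⟨x, hx⟩).2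
  · simp [hGg, hFf]

/-- `Diff^r(V)`, the group of all `C^r`-diffeomorphisms of `V` (under composition). -/
def DiffGroup {n : ℕ} (r : ℕ∞) (V : Set (EuclideanSpace ℝ (Fin n))) :
    Subgroup (Equiv.Perm V) where
  carrier := {f | IsCr r f ∧ IsCr r f.symm}
  one_mem' := ⟨⟨id, contDiffOn_id, fun _ => rfl⟩, ⟨id, contDiffOn_id, fun _ => rfl⟩⟩
  mul_mem' := fun {_ _} hf hg => ⟨hf.1.comp hg.1, hg.2.comp hf.2⟩
  inv_mem' := fun {_} hf => ⟨hf.2, hf.1⟩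

/-- `Diff^r(V, ∂V)`, the subgroup of `Diff^r(V)` fixing the boundary `∂V` pointwise. -/
def DiffRelBoundary {n : ℕ} (r : ℕ∞) (V : Set (EuclideanSpace ℝ (Fin n))) :
    Subgroup (Equiv.Perm V) :=
  DiffGroup r V ⊓ fixingSubgroup (Equiv.Perm V) {x : V | (x : EuclideanSpace ℝ (Fin n)) ∈ manifoldBoundary V}

/-! Place infinitely many disjoint copies `2 ^ k • (V + w)` of `V` in space. Let `f` act on each
copy by conjugation with the similarity, and as the identity elsewhere. Similarities preserve
Lipschitz constants but multiply displacements by `2 ^ k`, so one constant serves all copies, while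
a non-trivial `f` has unbounded displacement.

A `C^1` map of the compact `V` is Lipschitz (`IsCr.exists_dist_le`). The pieces glue without loss of
constant, because a segment leaving a copy crosses its boundary, which is fixed pointwise
(`exists_mem_segment`, `dist_copiesHom_le`). The inverse is handled by applying this to `f⁻¹`.

The lattice with a word metric is a coarse net in Euclidean space, and conjugating by it gives a
homomorphism `bilipToQI` whose kernel contains only maps of finite displacement. Infinite
displacement therefore yields both injectivity claims. -/

/-! ### Bi-Lipschitz homeomorphisms as quasi-isometries -/

section Coarse

variable {X Y : Type*} [MetricSpace X] [MetricSpace Y]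

/-- `i : X → Y` and `p : Y → X` are mutually inverse coarse equivalences of the simplest kind: `i` is
bi-Lipschitz onto its image and `i ∘ p` is at bounded distance from the identity. -/
structure IsCoarseNet (i : X → Y) (p : Y → X) (K c : ℝ) : Prop where
  one_le : 1 ≤ K
  nonneg : 0 ≤ c
  dist_map_le : ∀ x x', dist (i x) (i x') ≤ K * dist x x'
  dist_le : ∀ x x', dist x x' ≤ K * dist (i x) (i x')
  dist_retract_le : ∀ y, dist (i (p y)) y ≤ c

namespace IsCoarseNet

variable {i : X → Y} {p : Y → X} {K c : ℝ} (h : IsCoarseNet i p K c)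
include h

theorem dist_retract_retract_le (y y' : Y) : dist (p y) (p y') ≤ K * (dist y y' + 2 * c) := by
  have hK : 0 ≤ K := zero_le_one.trans h.one_le
  refine (h.dist_le _ _).trans ?_
  gcongr
  have h1 := dist_triangle4 (i (p y)) y y' (i (p y'))
  have h2 := h.dist_retract_le y
  have h3 := h.dist_retract_le y'
  rw [dist_comm] at h3
  linarith

theorem dist_le_retract_retract (y y' : Y) : dist y y' ≤ K * dist (p y) (p y') + 2 * c := by
  have h0 := h.dist_map_le (p y) (p y')
  have h1 := dist_triangle4 y (i (p y)) (i (p y')) y'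
  have h2 := h.dist_retract_le y
  have h3 := h.dist_retract_le y'
  rw [dist_comm] at h2
  linarith

theorem dist_retract_map_le (x : X) : dist (p (i x)) x ≤ K * c :=
  (h.dist_le _ _).trans
    (mul_le_mul_of_nonneg_left (h.dist_retract_le _) (zero_le_one.trans h.one_le))

/-- The maps `i` and `p` distort distances by bounded factors and errors. For coarse density, a
point near `y` is reached from `p z`, where `f z = i y`. -/
theorem isQuasiIsometry_conj {f : Y → Y} (hf : IsBilip f) (hs : Function.Surjective f) :
    IsQuasiIsometry fun x => p (f (i x)) := by
  obtain ⟨L, hL, hf⟩ := hf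
  have hK : 0 < K := zero_lt_one.trans_le h.one_le
  have hL0 : 0 < L := zero_lt_one.trans_le hL
  have hc := h.nonneg
  have hKK : 1 ≤ K * K := one_le_mul_of_one_le_of_one_le h.one_le h.one_le
  refine ⟨K * K * L, K * (2 * c), K * (L * c) + K * c,
    one_le_mul_of_one_le_of_one_le hKK hL, by positivity, fun x x' => ⟨?_, ?_⟩, fun y => ?_⟩
  · have h1 := h.dist_le_retract_retract (f (i x)) (f (i x'))
    have h2 : dist (i x) (i x') ≤ L * dist (f (i x)) (f (i x')) :=
      (inv_mul_le_iff₀ hL0).1 (hf _ _).1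
    have h3 := h.dist_le x x'
    have h4 : dist x x' ≤ K * (L * (K * dist (p (f (i x))) (p (f (i x'))) + 2 * c)) := by
      refine h3.trans ?_
      gcongr
      refine h2.trans ?_
      gcongr
    -- Once the factor `K * K * L` is cleared, the right side is the contribution of the additive
    -- constant `K * (2 * c)`.
    have h5 : K * L * (2 * c) ≤ K * K * (K * L * (2 * c)) :=
      le_mul_of_one_le_left (by positivity) hKK
    rw [sub_le_iff_le_add, inv_mul_le_iff₀ (by positivity)]
    nlinarith
  · refine (h.dist_retract_retract_le _ _).trans ?_
    have h1 : dist (f (i x)) (f (i x')) ≤ L * (K * dist x x') :=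
      (hf _ _).2.trans (by gcongr; exact h.dist_map_le _ _)
    have h2 := mul_le_mul_of_nonneg_left h1 hK.le
    linarith
  · obtain ⟨z, hz⟩ := hs (i y)
    refine ⟨p z, ?_⟩
    have h1 := h.dist_le (p (f (i (p z)))) y
    have h2 := dist_triangle (i (p (f (i (p z))))) (f (i (p z))) (f z)
    have h3 := h.dist_retract_le (f (i (p z)))
    have h4 : dist (f (i (p z))) (f z) ≤ L * c :=
      (hf _ _).2.trans (by gcongr; exact h.dist_retract_le z)
    rw [← hz] at h1
    have h5 : K * dist (i (p (f (i (p z))))) (f z) ≤ K * (c + L * c) := by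
      gcongr
      linarith
    linarith

/-- A coarse net `X` in `Y` turns bi-Lipschitz homeomorphisms of `Y` into elements of `QI(X)`. -/
def bilipToQI : Bilip Y →* QI X where
  toFun f := ((⟨fun x => p (f.1 (i x)), h.isQuasiIsometry_conj f.2 f.1.surjective⟩ :
    quasiIsometries X) : (quasiIsometryCon X).Quotient)
  map_one' := (quasiIsometryCon X).eq.2 ⟨K * c, fun x => h.dist_retract_map_le x⟩
  map_mul' := by
    rintro ⟨f, hf⟩ ⟨g, hg⟩
    obtain ⟨L, hL, hf'⟩ := id hf
    have hK : 0 < K := zero_lt_one.trans_le h.one_le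
    -- Inserting `i ∘ p` between `f` and `g` moves a point by at most `c`, which `f` stretches to `L
    -- * c` before `p` is applied.
    refine (quasiIsometryCon X).eq.2 ⟨K * (L * c + 2 * c), fun x => ?_⟩
    change dist (p (f (g (i x)))) (p (f (i (p (g (i x)))))) ≤ _
    refine (h.dist_retract_retract_le _ _).trans ?_
    gcongr
    refine (hf' _ _).2.trans ?_
    gcongr
    rw [dist_comm]
    exact h.dist_retract_le _

/-- Triviality in `QI X` bounds the displacement at net points. Every point is within `c` of one,
and `f` is Lipschitz. -/
theorem uniformDist_ne_top_of_bilipToQI_eq_one {f : Bilip Y} (hf : h.bilipToQI f = 1) :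
    uniformDist f.1 id ≠ ⊤ := by
  obtain ⟨B, hB⟩ := (quasiIsometryCon X).eq.1 hf
  obtain ⟨f, hf'⟩ := f
  obtain ⟨L, hL, hL'⟩ := hf'
  have hK : 0 < K := zero_lt_one.trans_le h.one_le
  have key : ∀ y, dist (f y) y ≤ L * c + (c + K * B) + c := fun y => by
    have h1 := dist_triangle4 (f y) (f (i (p y))) (i (p y)) y
    have h2 : dist (f y) (f (i (p y))) ≤ L * c := (hL' _ _).2.trans (by
      gcongr
      rw [dist_comm]
      exact h.dist_retract_le y)
    have h3 := h.dist_retract_le y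
    have h4 := dist_triangle (f (i (p y))) (i (p (f (i (p y))))) (i (p y))
    have h5 := h.dist_retract_le (f (i (p y)))
    rw [dist_comm] at h5
    have h6 : dist (i (p (f (i (p y))))) (i (p y)) ≤ K * B :=
      (h.dist_map_le _ _).trans (mul_le_mul_of_nonneg_left (hB (p y)) hK.le)
    linarith
  refine ne_top_of_le_ne_top ENNReal.ofReal_ne_top
    (b := ENNReal.ofReal (L * c + (c + K * B) + c)) (iSup_le fun y => ?_)
  rw [edist_dist]
  exact ENNReal.ofReal_le_ofReal (key y)

end IsCoarseNet

end Coarse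

/-! ### The integer lattice in Euclidean space -/

section Lattice

theorem wordLength_add_le {G : Type*} [AddGroup G] {A : Finset G}
    (hA : AddSubgroup.closure (A : Set G) = ⊤) (x y : G) :
    wordLength A (x + y) ≤ wordLength A x + wordLength A y := by
  obtain ⟨l, hn, hl, rfl⟩ := wordLength_spec hA x
  obtain ⟨m, hn', hm, rfl⟩ := wordLength_spec hA y
  rw [← hn, ← hn', ← List.length_append, ← List.sum_append]
  exact wordLength_le _ fun a ha => (List.mem_append.1 ha).elim (hl a) (hm a)

theorem wordLength_zero {G : Type*} [AddGroup G] (A : Finset G) : wordLength A 0 = 0 := by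
  simpa using wordLength_le (A := A) [] (by simp)

theorem wordLength_zsmul_le {G : Type*} [AddGroup G] {A : Finset G}
    (hA : AddSubgroup.closure (A : Set G) = ⊤) (m : ℤ) (x : G) :
    wordLength A (m • x) ≤ m.natAbs * wordLength A x := by
  have key : ∀ k : ℕ, wordLength A (k • x) ≤ k * wordLength A x := fun k => by
    induction k with
    | zero => simp [wordLength_zero]
    | succ k ih =>
      rw [succ_nsmul, add_mul, one_mul]
      exact (wordLength_add_le hA _ _).trans (by gcongr)
  rcases Int.natAbs_eq m with h | h
  · conv_lhs => rw [h, natCast_zsmul]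
    exact key _
  · conv_lhs => rw [h, neg_zsmul, natCast_zsmul]
    exact (wordLength_neg_le hA _).trans (key _)

theorem wordLength_sum_le {G ι : Type*} [AddCommGroup G] {A : Finset G}
    (hA : AddSubgroup.closure (A : Set G) = ⊤) (s : Finset ι) (x : ι → G) :
    wordLength A (∑ j ∈ s, x j) ≤ ∑ j ∈ s, wordLength A (x j) :=
  Finset.le_sum_of_subadditive _ (wordLength_zero A).le (wordLength_add_le hA) _ _

theorem norm_map_le_mul_wordLength {G E : Type*} [AddGroup G] [SeminormedAddCommGroup E]
    {A : Finset G} (hA : AddSubgroup.closure (A : Set G) = ⊤) (φ : G →+ E) (x : G) :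
    ‖φ x‖ ≤ (∑ a ∈ A, ‖φ a‖) * wordLength A x := by
  obtain ⟨l, hn, hl, rfl⟩ := wordLength_spec hA x
  rw [← hn]
  clear hn
  induction l with
  | nil => simp
  | cons a l ih =>
    have h1 : ‖φ a‖ ≤ ∑ a ∈ A, ‖φ a‖ := by
      rcases hl a (by simp) with h | h
      · exact Finset.single_le_sum (f := fun a => ‖φ a‖) (fun _ _ => norm_nonneg _) h
      · simpa using Finset.single_le_sum (f := fun a => ‖φ a‖) (fun _ _ => norm_nonneg _) h
    have h2 := ih fun b hb => hl b (by simp [hb])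
    rw [List.sum_cons, map_add, List.length_cons]
    push_cast
    have h3 := norm_add_le (φ a) (φ l.sum)
    linarith

/-- The inclusion of the integer lattice in Euclidean space. -/
def latticeInclusion (n : ℕ) : (Fin n → ℤ) →+ EuclideanSpace ℝ (Fin n) where
  toFun x := WithLp.toLp 2 fun j => (x j : ℝ)
  map_zero' := by ext; simp
  map_add' x y := by ext; simp

/-- Word length and Euclidean norm are comparable: the norm is at most `C` per letter, and expanding
a vector in the standard basis bounds its length by `D` times its norm. The retraction is the
coordinatewise floor, with error at most `√n`. -/
theorem exists_isCoarseNet_wordSpace {n : ℕ} (A : Finset (Fin n → ℤ))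
    (hA : AddSubgroup.closure (A : Set (Fin n → ℤ)) = ⊤) :
    ∃ (i : WordSpace A hA → EuclideanSpace ℝ (Fin n))
      (p : EuclideanSpace ℝ (Fin n) → WordSpace A hA) (K c : ℝ), IsCoarseNet i p K c := by
  set C := ∑ a ∈ A, ‖latticeInclusion n a‖ with hC
  set D := ∑ j : Fin n, (wordLength A (Pi.single j 1 : Fin n → ℤ) : ℝ) with hD
  have hC0 : 0 ≤ C := by positivity
  have hD0 : 0 ≤ D := by positivity
  have hdist : ∀ x y : Fin n → ℤ, dist (latticeInclusion n x) (latticeInclusion n y) =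
      ‖latticeInclusion n (-x + y)‖ := fun x y => by
    rw [dist_comm, dist_eq_norm, ← map_sub, sub_eq_neg_add]
  refine ⟨fun x => latticeInclusion n x, fun y => (fun j => ⌊y j⌋ : Fin n → ℤ), 1 + C + D, √n,
    by linarith, Real.sqrt_nonneg _, fun x y => ?_, fun x y => ?_, fun y => ?_⟩
  · refine (hdist x y).trans_le ((norm_map_le_mul_wordLength hA _ _).trans ?_)
    change _ ≤ _ * (wordLength A (-(show Fin n → ℤ from x) + (show Fin n → ℤ from y)) : ℝ)
    gcongr
    linarith
  · change (wordLength A (-(show Fin n → ℤ from x) + (show Fin n → ℤ from y)) : ℝ) ≤ _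
    rw [hdist x y]
    generalize -(show Fin n → ℤ from x) + (show Fin n → ℤ from y) = z
    have h1 : wordLength A z ≤ ∑ j, (z j).natAbs * wordLength A (Pi.single j 1 : Fin n → ℤ) := by
      conv_lhs => rw [pi_eq_sum_univ' z]
      refine (wordLength_sum_le hA _ _).trans (Finset.sum_le_sum fun j _ => ?_)
      convert wordLength_zsmul_le hA (z j) (Pi.single j 1) using 2
    have h2 : (wordLength A z : ℝ) ≤ D * ‖latticeInclusion n z‖ := by
      refine (Nat.cast_le.2 h1).trans ?_
      push_cast
      rw [hD, Finset.sum_mul]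
      refine Finset.sum_le_sum fun j _ => ?_
      rw [mul_comm]
      gcongr
      have := PiLp.norm_apply_le (latticeInclusion n z) j
      simpa [latticeInclusion, Nat.cast_natAbs] using this
    refine h2.trans ?_
    gcongr
    linarith
  · rw [dist_comm, EuclideanSpace.dist_eq]
    refine Real.sqrt_le_sqrt ?_
    refine (Finset.sum_le_card_nsmul _ _ 1 fun j _ => ?_).trans (by simp)
    have h0 := Int.fract_nonneg (y j)
    have h1 := (Int.fract_lt_one (y j)).le
    change dist (y j) (⌊y j⌋ : ℝ) ^ 2 ≤ 1
    rw [Real.dist_eq, Int.self_sub_floor, sq_abs]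
    nlinarith

end Lattice

/-! ### Lipschitz estimates on a submanifold with boundary -/

section Submanifold

variable {n : ℕ} {V : Set (EuclideanSpace ℝ (Fin n))}

/-- Near a boundary point `V` need not be convex, so the mean value inequality is used in a chart,
on the convex half-space, and pulled back along the locally Lipschitz chart. -/
theorem IsSmoothSubmanifoldWithBoundary.locallyLipschitzOn
    (hV : IsSmoothSubmanifoldWithBoundary V)
    {G : EuclideanSpace ℝ (Fin n) → EuclideanSpace ℝ (Fin n)} (hG : ContDiffOn ℝ 1 G V) :
    LocallyLipschitzOn V G := by
  intro x hx
  rcases hV x hx with hn | ⟨e, i, hxe, ⟨hsm, hsm'⟩, hiff⟩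
  · obtain ⟨K, t, ht, h⟩ := ((hG x hx).contDiffAt hn).exists_lipschitzOnWith
    exact ⟨K, t, mem_nhdsWithin_of_mem_nhds ht, h⟩
  · set H : Set (EuclideanSpace ℝ (Fin n)) := {u | 0 ≤ u i} with hH
    have hconv : Convex ℝ H :=
      convex_halfSpace_ge (f := fun u : EuclideanSpace ℝ (Fin n) => u i)
        ⟨fun _ _ => rfl, fun _ _ => rfl⟩ 0
    have hmaps : Set.MapsTo e.symm (e.target ∩ H) V := fun u hu => by
      rw [hiff _ (e.map_target hu.1), e.right_inv hu.1]
      exact hu.2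
    have hexH : e x ∈ H := (hiff x hxe).1 hx
    have hcomp : ContDiffWithinAt ℝ 1 (G ∘ e.symm) H (e x) := by
      have h1 : ContDiffOn ℝ 1 (G ∘ e.symm) (e.target ∩ H) :=
        hG.comp ((hsm'.of_le (by exact_mod_cast le_top)).mono Set.inter_subset_left) hmaps
      refine (h1 (e x) ⟨e.map_source hxe, hexH⟩).mono_of_mem_nhdsWithin ?_
      exact Filter.inter_mem (mem_nhdsWithin_of_mem_nhds (e.open_target.mem_nhds
        (e.map_source hxe))) self_mem_nhdsWithin
    obtain ⟨K, t, ht, hK⟩ := hcomp.exists_lipschitzOnWith hconv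
    have he1 : ContDiffAt ℝ 1 e x :=
      ((hsm x hxe).contDiffAt (e.open_source.mem_nhds hxe)).of_le (by exact_mod_cast le_top)
    obtain ⟨M, s, hs, hM⟩ := he1.exists_lipschitzOnWith
    have htend : Filter.Tendsto e (nhdsWithin x V) (nhdsWithin (e x) H) := by
      refine tendsto_nhdsWithin_iff.2
        ⟨he1.continuousAt.tendsto.mono_left nhdsWithin_le_nhds, ?_⟩
      filter_upwards [self_mem_nhdsWithin,
        mem_nhdsWithin_of_mem_nhds (e.open_source.mem_nhds hxe)] with y hy hye
      exact (hiff y hye).1 hy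
    refine ⟨K * M, e.source ∩ s ∩ e ⁻¹' t, Filter.inter_mem (mem_nhdsWithin_of_mem_nhds
      (Filter.inter_mem (e.open_source.mem_nhds hxe) hs)) (htend ht), ?_⟩
    have h2 : LipschitzOnWith (K * M) ((G ∘ e.symm) ∘ e) (e.source ∩ s ∩ e ⁻¹' t) :=
      hK.comp (hM.mono fun y hy => hy.1.2) fun y hy => hy.2
    intro y hy z hz
    have h3 := h2 hy hz
    simpa [e.left_inv hy.1.1, e.left_inv hz.1.1] using h3

theorem IsCr.exists_dist_le {r : ℕ∞} (hr : 1 ≤ r) (hV : IsSmoothSubmanifoldWithBoundary V)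
    (hVc : IsCompact V) {f : V → V} (hf : IsCr r f) :
    ∃ L : ℝ, 1 ≤ L ∧ ∀ x y : V, dist (f x) (f y) ≤ L * dist x y := by
  obtain ⟨G, hG, hGf⟩ := hf
  obtain ⟨K, hK⟩ := (hV.locallyLipschitzOn
    (hG.of_le (by exact_mod_cast hr))).exists_lipschitzOnWith_of_compact hVc
  -- The constant must also serve the identity off the copies, hence the `1`.
  refine ⟨max 1 K, le_max_left _ _, fun x y => ?_⟩
  have h := hK.dist_le_mul x x.2 y y.2
  rw [hGf, hGf] at h
  exact h.trans (mul_le_mul_of_nonneg_right (le_max_right _ _) dist_nonneg)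

theorem IsSmoothSubmanifoldWithBoundary.mem_manifoldBoundary
    (hV : IsSmoothSubmanifoldWithBoundary V) {x : EuclideanSpace ℝ (Fin n)} (hx : x ∈ V)
    (hx' : x ∉ interior V) : x ∈ manifoldBoundary V := by
  rcases hV x hx with hn | ⟨e, i, hxe, he⟩
  · exact absurd (mem_interior_iff_mem_nhds.2 hn) hx'
  · refine ⟨hx, e, i, hxe, he, ?_⟩
    by_contra hne
    have hpos : 0 < e x i := lt_of_le_of_ne ((he.2 x hxe).1 hx) (Ne.symm hne)
    refine hx' (mem_interior_iff_mem_nhds.2 ?_)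
    have hc : ContinuousAt (fun y => e y i) x :=
      ((PiLp.continuous_apply 2 _ i).continuousAt).comp (e.continuousAt hxe)
    filter_upwards [hc.eventually (lt_mem_nhds hpos), e.open_source.mem_nhds hxe] with y hy hye
    exact (he.2 y hye).2 hy.le

/-- Otherwise the interior and the complement of `V` would disconnect the segment. Equality in the
triangle inequality is what lets estimates on the two halves add up without loss. -/
theorem IsSmoothSubmanifoldWithBoundary.exists_mem_segment
    (hV : IsSmoothSubmanifoldWithBoundary V) (hVc : IsClosed V)
    {x y : EuclideanSpace ℝ (Fin n)} (hx : x ∈ V) (hy : y ∉ V) :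
    ∃ z ∈ manifoldBoundary V, dist x z + dist z y = dist x y := by
  obtain ⟨z, hzs, hz⟩ : ∃ z ∈ segment ℝ x y, z ∈ V ∧ z ∉ interior V := by
    by_contra! hcon
    obtain ⟨z, -, hz1, hz2⟩ := (convex_segment (𝕜 := ℝ) x y).isPreconnected (interior V) Vᶜ
      isOpen_interior hVc.isOpen_compl
      (fun z hz => (em (z ∈ V)).imp (hcon z hz) id)
      ⟨x, left_mem_segment ℝ x y, hcon x (left_mem_segment ℝ x y) hx⟩
      ⟨y, right_mem_segment ℝ x y, hy⟩
    exact hz2 (interior_subset hz1)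
  exact ⟨z, hV.mem_manifoldBoundary hz.1 hz.2, dist_add_dist_of_mem_segment hzs⟩

end Submanifold

/-! ### Acting on infinitely many rescaled copies -/

section Copies

variable {E : Type*} [NormedAddCommGroup E] [NormedSpace ℝ E]

/-- The `k`-th rescaling of the translation by `w`. -/
noncomputable def rescale (w : E) (k : ℕ) (x : E) : E := (2 : ℝ) ^ k • (x + w)

theorem dist_rescale (w : E) (k : ℕ) (x y : E) :
    dist (rescale w k x) (rescale w k y) = 2 ^ k * dist x y := by
  rw [rescale, rescale, dist_smul₀, dist_add_right]
  simp

theorem rescale_surjective (w : E) (k : ℕ) : Function.Surjective (rescale w k) := fun y =>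
  ⟨((2 : ℝ) ^ k)⁻¹ • y - w, by simp [rescale, smul_smul]⟩

/-- The translate `V + w` lies in the shell of radii `3 * R` and `5 * R`. Since `2 * 3 > 5`, its
dilates by distinct powers of `2` are disjoint. -/
theorem rescale_copies_injective {V : Set E} {R : ℝ} (hR : 0 < R) (hV : ∀ x ∈ V, ‖x‖ ≤ R) {w : E}
    (hw : ‖w‖ = 4 * R) : Function.Injective fun q : ℕ × V => rescale w q.1 q.2 := by
  have hle : ∀ k m : ℕ, ∀ x ∈ V, ∀ y ∈ V, rescale w k x = rescale w m y → m ≤ k := by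
    intro k m x hx y hy h
    by_contra! hlt
    have h1 : ‖x + w‖ ≤ 5 * R := by linarith [norm_add_le x w, hV x hx]
    have h2 : 3 * R ≤ ‖y + w‖ := by
      have := norm_sub_norm_le w (-y)
      rw [norm_neg, sub_neg_eq_add, add_comm w y] at this
      linarith [hV y hy]
    have h3 := congrArg norm h
    simp only [rescale, norm_smul, norm_pow, Real.norm_ofNat] at h3
    have h4 : (2 : ℝ) ^ (k + 1) ≤ 2 ^ m := pow_le_pow_right₀ one_le_two hlt
    have h5 : (0 : ℝ) < 2 ^ k := by positivity
    have h6 : (2 : ℝ) ^ (k + 1) * (3 * R) ≤ 2 ^ m * ‖y + w‖ := by gcongr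
    have h7 : (2 : ℝ) ^ k * ‖x + w‖ ≤ 2 ^ k * (5 * R) := by gcongr
    rw [pow_succ] at h6
    nlinarith [mul_pos h5 hR]
  rintro ⟨k, x⟩ ⟨m, y⟩ h
  obtain rfl : k = m := le_antisymm (hle m k y y.2 x x.2 h.symm) (hle k m x x.2 y y.2 h)
  have h1 : (2 : ℝ) ^ k • ((x : E) + w) = (2 : ℝ) ^ k • ((y : E) + w) := h
  have h2 := smul_right_injective E (pow_ne_zero k (two_ne_zero (α := ℝ))) h1
  exact Prod.ext rfl (Subtype.ext (add_right_cancel h2))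

open scoped Classical in
/-- Let a permutation of `V` act simultaneously on all the rescaled copies of `V`. -/
noncomputable def copiesHom {V : Set E} {w : E}
    (hj : Function.Injective fun q : ℕ × V => rescale w q.1 q.2) :
    Equiv.Perm V →* Equiv.Perm E :=
  (Equiv.Perm.extendDomainHom (Equiv.ofInjective _ hj)).comp
    { toFun := fun f => Equiv.prodCongrRight fun _ : ℕ => f
      map_one' := rfl
      map_mul' := fun _ _ => rfl }

variable {V : Set E} {w : E} (hj : Function.Injective fun q : ℕ × V => rescale w q.1 q.2)

theorem copiesHom_rescale (f : Equiv.Perm V) (k : ℕ) (x : V) :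
    copiesHom hj f (rescale w k x) = rescale w k (f x) := by
  classical
  exact Equiv.Perm.extendDomain_apply_image (Equiv.prodCongrRight fun _ : ℕ => f)
    (Equiv.ofInjective _ hj) (k, x)

theorem copiesHom_of_forall_ne (f : Equiv.Perm V) {y : E}
    (hy : ∀ (k : ℕ) (x : V), rescale w k x ≠ y) : copiesHom hj f y = y := by
  classical
  refine Equiv.Perm.extendDomain_apply_not_subtype (Equiv.prodCongrRight fun _ : ℕ => f)
    (Equiv.ofInjective _ hj) ?_
  rintro ⟨⟨k, x⟩, h⟩
  exact hy k x h

/-- Within a copy the bound is that of `f`. A pair not in a common copy is split at a fixed point of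
the joining segment, where the image copy of `B` is crossed. -/
theorem dist_copiesHom_le {B : Set E} (hBV : B ⊆ V)
    (hB : ∀ x ∈ V, ∀ y ∉ V, ∃ z ∈ B, dist x z + dist z y = dist x y) {f : Equiv.Perm V}
    (hf : ∀ z : V, (z : E) ∈ B → f z = z) {L : ℝ} (hL : 1 ≤ L)
    (hfL : ∀ x y : V, dist (f x) (f y) ≤ L * dist x y) (x y : E) :
    dist (copiesHom hj f x) (copiesHom hj f y) ≤ L * dist x y := by
  have hsame : ∀ (k : ℕ) (a b : V),
      dist (copiesHom hj f (rescale w k a)) (copiesHom hj f (rescale w k b)) ≤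
        L * dist (rescale w k (a : E)) (rescale w k b) := fun k a b => by
    rw [copiesHom_rescale, copiesHom_rescale, dist_rescale, dist_rescale, mul_left_comm]
    have := hfL a b
    gcongr
    exact this
  have hsep : ∀ (k : ℕ) (a : V) (y : E), (∀ b : V, rescale w k b ≠ y) →
      ∃ z : V, copiesHom hj f (rescale w k z) = rescale w k z ∧
        dist (rescale w k (a : E)) (rescale w k z) + dist (rescale w k (z : E)) y =
          dist (rescale w k (a : E)) y := fun k a y hy => by
    obtain ⟨b, rfl⟩ := rescale_surjective w k y
    obtain ⟨z, hz, hd⟩ := hB a a.2 b fun hb => hy ⟨b, hb⟩ rfl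
    refine ⟨⟨z, hBV hz⟩, ?_, ?_⟩
    · rw [copiesHom_rescale, hf ⟨z, hBV hz⟩ hz]
    · simp only [dist_rescale, ← mul_add, hd]
  -- With one endpoint fixed, a single splitting suffices. The general case splits once and applies
  -- this to the remaining half.
  have hfix : ∀ x y : E, copiesHom hj f y = y →
      dist (copiesHom hj f x) (copiesHom hj f y) ≤ L * dist x y := fun x y hy => by
    by_cases hx : ∃ (k : ℕ) (a : V), rescale w k a = x
    · obtain ⟨k, a, rfl⟩ := hx
      by_cases hyk : ∃ b : V, rescale w k b = y
      · obtain ⟨b, rfl⟩ := hyk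
        exact hsame k a b
      · obtain ⟨z, hz, hd⟩ := hsep k a y fun b hb => hyk ⟨b, hb⟩
        have h1 := hsame k a z
        have h2 := dist_triangle (copiesHom hj f (rescale w k a))
          (copiesHom hj f (rescale w k z)) (copiesHom hj f y)
        have h3 : dist (copiesHom hj f (rescale w k z)) (copiesHom hj f y) ≤
            L * dist (rescale w k (z : E)) y := by
          rw [hz, hy]
          exact le_mul_of_one_le_left dist_nonneg hL
        rw [← hd, mul_add]
        linarith
    · push Not at hx
      rw [copiesHom_of_forall_ne hj f hx, hy]
      exact le_mul_of_one_le_left dist_nonneg hL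
  by_cases hx : ∃ (k : ℕ) (a : V), rescale w k a = x
  · obtain ⟨k, a, rfl⟩ := hx
    by_cases hyk : ∃ b : V, rescale w k b = y
    · obtain ⟨b, rfl⟩ := hyk
      exact hsame k a b
    · obtain ⟨z, hz, hd⟩ := hsep k a y fun b hb => hyk ⟨b, hb⟩
      have h1 := hsame k a z
      have h2 := dist_triangle (copiesHom hj f (rescale w k a))
        (copiesHom hj f (rescale w k z)) (copiesHom hj f y)
      have h3 := hfix y (rescale w k z) hz
      rw [dist_comm, dist_comm y] at h3
      rw [← hd, mul_add]
      linarith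
  · push Not at hx
    rw [dist_comm, dist_comm x]
    exact hfix y x (copiesHom_of_forall_ne hj f hx)

theorem iSup_edist_copiesHom {f : Equiv.Perm V} (hf : f ≠ 1) :
    ⨆ x, edist (copiesHom hj f x) x = ⊤ := by
  obtain ⟨a, ha⟩ : ∃ a, f a ≠ a := by
    by_contra! h
    exact hf (Equiv.ext h)
  have hd : 0 < dist ((f a : V) : E) a := dist_pos.2 fun h => ha (Subtype.ext h)
  refine ENNReal.eq_top_of_forall_nnreal_le fun B => ?_
  obtain ⟨k, hk⟩ := pow_unbounded_of_one_lt ((B : ℝ) / dist ((f a : V) : E) a) one_lt_two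
  refine le_trans ?_ (le_iSup _ (rescale w k (a : E)))
  rw [copiesHom_rescale, edist_dist, dist_rescale, ← ENNReal.ofReal_coe_nnreal]
  exact ENNReal.ofReal_le_ofReal ((div_le_iff₀ hd).1 hk.le)

end Copies

/-- An action by Lipschitz permutations is an action by bi-Lipschitz homeomorphisms. -/
theorem exists_monoidHom_bilip {G X : Type*} [Group G] [MetricSpace X] (φ : G →* Equiv.Perm X)
    (hφ : ∀ g, ∃ L : ℝ, 1 ≤ L ∧ ∀ x y, dist (φ g x) (φ g y) ≤ L * dist x y) :
    ∃ Φ : G →* Bilip X, ∀ g x, (Φ g).1 x = φ g x := by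
  have hcont : ∀ g, Continuous (φ g) := fun g => by
    obtain ⟨L, hL, h⟩ := hφ g
    exact (LipschitzWith.of_dist_le_mul (K := L.toNNReal) fun x y => by
      rw [Real.coe_toNNReal _ (by linarith)]; exact h x y).continuous
  have hinv : ∀ g x, (φ g).symm x = φ g⁻¹ x := fun g x => by rw [map_inv]; rfl
  let T : G → (X ≃ₜ X) := fun g =>
    { toEquiv := φ g
      continuous_toFun := hcont g
      continuous_invFun := (hcont g⁻¹).congr fun x => (hinv g x).symm }
  have hT : ∀ g, IsBilip (T g) := fun g => by
    obtain ⟨L, hL, h⟩ := hφ g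
    obtain ⟨M, hM, h'⟩ := hφ g⁻¹
    refine ⟨max L M, hL.trans (le_max_left _ _), fun x y => ⟨?_, ?_⟩⟩
    -- The lower bound is the Lipschitz bound for `g⁻¹`.
    · rw [inv_mul_le_iff₀ (by positivity)]
      have h1 := h' (φ g x) (φ g y)
      rw [← hinv, ← hinv, Equiv.symm_apply_apply, Equiv.symm_apply_apply] at h1
      exact h1.trans (mul_le_mul_of_nonneg_right (le_max_right _ _) dist_nonneg)
    · exact (h x y).trans (mul_le_mul_of_nonneg_right (le_max_left _ _) dist_nonneg)
  exact ⟨{ toFun := fun g => ⟨T g, hT g⟩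
           map_one' := Subtype.ext (Homeomorph.ext fun x => by
            change φ 1 x = x
            rw [map_one]; rfl)
           map_mul' := fun g h => Subtype.ext (Homeomorph.ext fun x => by
            change φ (g * h) x = φ g (φ h x)
            rw [map_mul]; rfl) }, fun _ _ => rfl⟩

theorem exists_bilip_embedding {n : ℕ} {r : ℕ∞} (hr : 1 ≤ r)
    {V : Set (EuclideanSpace ℝ (Fin n))} (hVm : IsSmoothSubmanifoldWithBoundary V)
    (hVcpt : IsCompact V) :
    ∃ Ψ : DiffRelBoundary r V →* Bilip (EuclideanSpace ℝ (Fin n)),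
      ∀ f : DiffRelBoundary r V, f ≠ 1 → uniformDist (Ψ f).1 id = ⊤ := by
  -- In dimension zero no vector `w` of positive norm exists, but the group is trivial.
  rcases n.eq_zero_or_pos with rfl | hn
  · exact ⟨1, fun f hf => absurd (Subtype.ext (Equiv.ext fun _ => Subsingleton.elim _ _)) hf⟩
  obtain ⟨R, hR, hVR⟩ : ∃ R : ℝ, 0 < R ∧ ∀ x ∈ V, ‖x‖ ≤ R :=
    hVcpt.isBounded.exists_pos_norm_le
  obtain ⟨w, hw⟩ : ∃ w : EuclideanSpace ℝ (Fin n), ‖w‖ = 4 * R :=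
    ⟨EuclideanSpace.single ⟨0, hn⟩ (4 * R), by simp [abs_of_pos hR]⟩
  have hj := rescale_copies_injective hR hVR hw
  obtain ⟨Φ, hΦ⟩ := exists_monoidHom_bilip
    ((copiesHom hj).comp (DiffRelBoundary r V).subtype) fun f => by
      obtain ⟨L, hL, h⟩ := f.2.1.1.exists_dist_le hr hVm hVcpt
      exact ⟨L, hL, dist_copiesHom_le hj (B := manifoldBoundary V) (fun x hx => hx.1)
        (fun x hx y hy => hVm.exists_mem_segment hVcpt.isClosed hx hy)
        (fun z hz => (mem_fixingSubgroup_iff _).1 f.2.2 z hz) hL h⟩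
  refine ⟨Φ, fun f hf => ?_⟩
  rw [← iSup_edist_copiesHom hj fun h => hf (Subtype.ext h)]
  exact iSup_congr fun x => by rw [hΦ]; rfl

theorem uniformDist_one_id {X : Type*} [MetricSpace X] : uniformDist (1 : Bilip X).1 id = 0 := by
  refine ENNReal.iSup_eq_zero.2 fun x => ?_
  exact edist_self x

theorem mainTheorem2 (n : ℕ) (r : ℕ∞) (hr : 1 ≤ r) (V : Set (EuclideanSpace ℝ (Fin n)))
    (hVm : IsSmoothSubmanifoldWithBoundary V) (hVcpt : IsCompact V) (hVconn : IsConnected V) :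
    (∃ Ψ : DiffRelBoundary r V →* Bilip (EuclideanSpace ℝ (Fin n)),
      Function.Injective Ψ ∧
      ∀ f : DiffRelBoundary r V, f ≠ 1 → uniformDist (Ψ f).1 id = ⊤) ∧
    ∀ (A : Finset (Fin n → ℤ)) (hA : AddSubgroup.closure (A : Set (Fin n → ℤ)) = ⊤),
      ∃ Θ : DiffRelBoundary r V →* QI (WordSpace A hA), Function.Injective Θ := by
  obtain ⟨Ψ, hΨ⟩ := exists_bilip_embedding hr hVm hVcpt
  refine ⟨⟨Ψ, (injective_iff_map_eq_one Ψ).2 fun f hf => ?_, hΨ⟩, fun A hA => ?_⟩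
  · by_contra hne
    have h := hΨ f hne
    rw [hf, uniformDist_one_id] at h
    exact ENNReal.zero_ne_top h
  · obtain ⟨i, p, K, c, h⟩ := exists_isCoarseNet_wordSpace A hA
    refine ⟨h.bilipToQI.comp Ψ, (injective_iff_map_eq_one _).2 fun f hf => ?_⟩
    by_contra hne
    exact h.uniformDist_ne_top_of_bilipToQI_eq_one hf (hΨ f hne)
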